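/- Let $\nu\in\mathbb{C}$ with $\operatorname{Re}\nu\ge 0$, let $k\ge 1$ be an integer, let $I\subset(0,\infty)$ be a nondegenerate interval, and let $f\in C^{2k}(I)$ be complex-valued (with one-sided derivatives at any endpoint of $I$ belonging to $I$). Write $D=\frac{d}{dx}$, let ${}_2F_1$ be the Gauss hypergeometric function, and put $$B=B_\nu=D^2+\frac{\nu}{x}D,\qquad C_\nu g=D^2g-D\Bigl(\frac{\nu}{x}\,g\Bigr).$$ For continuous $g$ on $I$, define the Bessel fractional integrals $$(B_{b-}^{\nu,k}g)(x)=\frac{1}{\Gamma(2k)}\int_x^b\Bigl(\frac{y^2-x^2}{2y}\Bigr)^{2k-1}{}_2F_1\Bigl(k+\frac{\nu-1}{2},k;2k;1-\frac{x^2}{y^2}\Bigr)g(y)\,dy\quad(x\le b),$$ $$(B_{a+}^{\nu,k}g)(x)=\frac{1}{\Gamma(2k)}\int_a^x\Bigl(\frac{x^2-y^2}{2x}\Bigr)^{2k-1}{}_2F_1\Bigl(k+\frac{\nu-1}{2},k;2k;1-\frac{y^2}{x^2}\Bigr)g(y)\,dy\quad(a\le x).$$ (1) For all $x,b\in I$ with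 $x\le b$, the integral $B_{b-}^{\nu,k}(B^kf)(x)$ converges absolutely and $$f(x)=\sum_{i=1}^{k}\Biggl\{\frac{1}{\Gamma(2i-1)}\Bigl(\frac{b^2-x^2}{2b}\Bigr)^{2i-2}{}_2F_1\Bigl(i+\frac{\nu-1}{2},i-1;2i-1;1-\frac{x^2}{b^2}\Bigr)(B^{i-1}f)(b)$$ $$-\frac{1}{\Gamma(2i)}\Bigl(\frac{b^2-x^2}{2b}\Bigr)^{2i-1}{}_2F_1\Bigl(i+\frac{\nu-1}{2},i;2i;1-\frac{x^2}{b^2}\Bigr)(DB^{i-1}f)(b)\Biggr\}+B_{b-}^{\nu,k}(B^kf)(x).$$ (2) For all $a,x\in I$ with $a\le x$, the integral $B_{a+}^{\nu,k}(C_\nu^kf)(x)$ converges absolutely and $$f(x)=\sum_{i=1}^{k}\Biggl\{\frac{1}{\Gamma(2i-1)}\Bigl(\frac{x^2-a^2}{2x}\Bigr)^{2i-2}\frac{a}{x}\;{}_2F_1\Bigl(i+\frac{\nu-1}{2},i;2i-1;1-\frac{a^2}{x^2}\Bigr)(C_\nu^{i-1}f)(a)$$ $$+\frac{1}{\Gamma(2i)}\Bigl(\frac{x^2-a^2}{2x}\Bigr)^{2i-1}{}_2F_1\Bigl(i+\frac{\nu-1}{2},i;2i;1-\frac{a^2}{x^2}\Bigr)\,a^{\nu}\,\bigl(D\,x^{-\nu}C_\nu^{i-1}f\bigr)(a)\Biggr\}+B_{a+}^{\nu,k}(C_\nu^kf)(x).$$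 -/

import Mathlib

open Set MeasureTheory

noncomputable section

/-- The Bessel operator `B_ν g = D² g + (ν / x) D g` for functions on an interval `I` of the
positive half-line. Derivatives are taken within `I`, hence one-sided at the endpoints that
belong to `I`. -/
def besselOp (ν : ℂ) (I : Set ℝ) (g : ℝ → ℂ) : ℝ → ℂ := fun x =>
  derivWithin (derivWithin g I) I x + ν / (x : ℂ) * derivWithin g I x

/-- The formal adjoint of the Bessel operator, `C_ν g = D² g - D ((ν / x) g)`, on an interval
`I` of the positive half-line. -/
def besselAdjointOp (ν : ℂ) (I : Set ℝ) (g : ℝ → ℂ) : ℝ → ℂ := fun x =>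
  derivWithin (derivWithin g I) I x - derivWithin (fun y : ℝ => ν / (y : ℂ) * g y) I x

/-- The kernel of `B_{b-}^{ν,k}`, for `0 < x ≤ y`:
`((y² - x²) / (2y))^(2k-1) ₂F₁(k + (ν-1)/2, k; 2k; 1 - x²/y²)`. -/
def besselKernelRight (ν : ℂ) (k : ℕ) (x y : ℝ) : ℂ :=
  (((y : ℂ) ^ 2 - (x : ℂ) ^ 2) / (2 * (y : ℂ))) ^ (2 * k - 1) *
    ordinaryHypergeometric ((k : ℂ) + (ν - 1) / 2) (k : ℂ) (2 * (k : ℂ))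
      (1 - (x : ℂ) ^ 2 / (y : ℂ) ^ 2)

/-- The kernel of `B_{a+}^{ν,k}`, for `0 < y ≤ x`:
`((x² - y²) / (2x))^(2k-1) ₂F₁(k + (ν-1)/2, k; 2k; 1 - y²/x²)`. -/
def besselKernelLeft (ν : ℂ) (k : ℕ) (x y : ℝ) : ℂ :=
  (((x : ℂ) ^ 2 - (y : ℂ) ^ 2) / (2 * (x : ℂ))) ^ (2 * k - 1) *
    ordinaryHypergeometric ((k : ℂ) + (ν - 1) / 2) (k : ℂ) (2 * (k : ℂ))
      (1 - (y : ℂ) ^ 2 / (x : ℂ) ^ 2)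

/-- The Bessel fractional integral `B_{b-}^{ν,k} g`, with integration over `[x, b]`. -/
def besselIntegralRight (ν : ℂ) (k : ℕ) (b : ℝ) (g : ℝ → ℂ) : ℝ → ℂ := fun x =>
  1 / Complex.Gamma (2 * (k : ℂ)) * ∫ y in x..b, besselKernelRight ν k x y * g y

/-- The Bessel fractional integral `B_{a+}^{ν,k} g`, with integration over `[a, x]`. -/
def besselIntegralLeft (ν : ℂ) (k : ℕ) (a : ℝ) (g : ℝ → ℂ) : ℝ → ℂ := fun x =>
  1 / Complex.Gamma (2 * (k : ℂ)) * ∫ y in a..x, besselKernelLeft ν k x y * g y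

end

/-! The formula is a repeated integration by parts in the base point `y`, organised as a telescoping
sum. Write `R_k(x, y)` for `besselRiesz`, the integral kernel with its factor `1 / Γ(2k)`, so that
`R_0 = 0`, and `T_i`, `L_i` for the coefficients `besselTaylorRight`, `besselTaylorLeft`.

On the right, `∂_y R_{j+1} = T_{j+1} + (ν/y) R_{j+1}` and `∂_y T_{j+1} = R_j`. Hence, with `g = B^j
f`, the `y`-derivative of `R_{j+1} Dg - T_{j+1} g` is `R_{j+1} Bg - R_j g`. Summing over `j < k`
leaves `R_k B^k f`, and the fundamental theorem of calculus on `[x, b]` gives the formula: on the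
diagonal all coefficients vanish except `T_1 = 1`, which yields `f(x)`.

On the left the kernel is `R_k(y, x)`, with `∂_y R_{j+1}(y, x) = -L_{j+1}` and `∂_y L_{j+1} =
-R_j(y, x) - (ν/y) L_{j+1}`. With `g = C_ν^j f`, the derivative of `L_{j+1} g + R_{j+1}(y, x) (Dg -
(ν/y) g)` is `R_{j+1}(y, x) C_ν g - R_j(y, x) g`, which telescopes in the same way.

These derivative formulas are contiguous relations for `₂F₁`:
`ordinaryHypergeometric_contiguous_lower`, `ordinaryHypergeometric_contiguous_middle` and
`ordinaryHypergeometric_contiguous_upper`, each obtained by comparing power series coefficients. -/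

/-! ### The Gauss series in the unit disc and its coefficients. -/

/-- Term-by-term differentiation of a complex power series inside the unit disc. -/
theorem FormalMultilinearSeries.exists_hasDerivAt_sum_of_one_le_radius
    (p : FormalMultilinearSeries ℂ ℂ ℂ) (hp : 1 ≤ p.radius) {z : ℂ} (hz : ‖z‖ < 1) :
    HasSum (fun n => p.coeff n * z ^ n) (p.sum z) ∧
    ∃ d, HasDerivAt p.sum d z ∧ HasSum (fun n : ℕ => n * p.coeff n * z ^ n) (z * d) := by
  have hpos : 0 < p.radius := lt_of_lt_of_le one_pos hp
  have hball := p.hasFPowerSeriesOnBall hpos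
  have hz' : z ∈ Metric.eball (0 : ℂ) p.radius := by
    simp only [Metric.mem_eball, edist_zero_right]
    refine lt_of_lt_of_le ?_ hp
    rw [← enorm_one (G := ℂ)]
    simpa [enorm_eq_nnnorm, ← NNReal.coe_lt_coe] using hz
  constructor
  · have := hball.hasSum hz'
    simpa [mul_comm] using this
  · have hd : DifferentiableAt ℂ p.sum z :=
      (hball.analyticOnNhd z hz').differentiableAt
    refine ⟨deriv p.sum z, hd.hasDerivAt, ?_⟩
    have h1 := hball.fderiv.hasSum hz'
    have h2 := h1.mapL (ContinuousLinearMap.apply ℂ ℂ (1 : ℂ))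
    have h3 := h2.mul_left z
    -- The `n = 0` term of the series for `z d` is zero; dropping it aligns the rest with the
    -- derivative series multiplied by `z`.
    rw [← hasSum_nat_add_iff' 1]
    simp only [Finset.range_one, Finset.sum_singleton, Nat.cast_zero, zero_mul, sub_zero]
    convert! h3 using 2 with n
    · have := p.derivSeries_coeff_one n
      simp only [ContinuousLinearMap.apply_apply]
      rw [FormalMultilinearSeries.apply_eq_pow_smul_coeff]
      simp [this, pow_succ]
      ring
    · simp

/-- If a parameter is a nonpositive integer the series terminates and the radius is infinite. This
includes the lower parameter, since the inverse of zero is zero. -/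
theorem one_le_radius_ordinaryHypergeometricSeries (a b c : ℂ) :
    1 ≤ (ordinaryHypergeometricSeries ℂ a b c).radius := by
  by_cases h : ∀ k : ℕ, ↑k ≠ -a ∧ ↑k ≠ -b ∧ ↑k ≠ -c
  · exact (ordinaryHypergeometricSeries_radius_eq_one ℂ a b c h).ge
  · push Not at h
    obtain ⟨k, hk⟩ := h
    by_cases ha : (k : ℂ) = -a
    · obtain rfl : a = -(k : ℂ) := by rw [ha, neg_neg]
      simp [ordinaryHypergeometric_radius_top_of_neg_nat₁]
    by_cases hb : (k : ℂ) = -b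
    · obtain rfl : b = -(k : ℂ) := by rw [hb, neg_neg]
      simp [ordinaryHypergeometric_radius_top_of_neg_nat₂]
    obtain rfl : c = -(k : ℂ) := by rw [hk ha hb, neg_neg]
    simp [ordinaryHypergeometric_radius_top_of_neg_nat₃]

theorem ordinaryHypergeometric_hasSum (a b c : ℂ) {z : ℂ} (hz : ‖z‖ < 1) :
    HasSum (fun n => ordinaryHypergeometricCoefficient a b c n * z ^ n)
      (ordinaryHypergeometric a b c z) := by
  simpa [ordinaryHypergeometricSeries, ordinaryHypergeometric] using
    ((ordinaryHypergeometricSeries ℂ a b c).exists_hasDerivAt_sum_of_one_le_radius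
      (one_le_radius_ordinaryHypergeometricSeries a b c) hz).1

theorem ordinaryHypergeometric_exists_hasDerivAt (a b c : ℂ) {z : ℂ} (hz : ‖z‖ < 1) :
    ∃ d, HasDerivAt (ordinaryHypergeometric a b c) d z ∧
      HasSum (fun n : ℕ => n * ordinaryHypergeometricCoefficient a b c n * z ^ n) (z * d) := by
  obtain ⟨d, hd, hs⟩ := ((ordinaryHypergeometricSeries ℂ a b c).exists_hasDerivAt_sum_of_one_le_radius
      (one_le_radius_ordinaryHypergeometricSeries a b c) hz).2
  exact ⟨d, hd, by simpa [ordinaryHypergeometricSeries] using hs⟩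

theorem ordinaryHypergeometric_differentiableAt (a b c : ℂ) {z : ℂ} (hz : ‖z‖ < 1) :
    DifferentiableAt ℂ (ordinaryHypergeometric a b c) z :=
  let ⟨_, h, _⟩ := ordinaryHypergeometric_exists_hasDerivAt a b c hz
  h.differentiableAt

theorem ordinaryHypergeometric_comm (a b c z : ℂ) :
    ordinaryHypergeometric a b c z = ordinaryHypergeometric b a c z := by
  rw [ordinaryHypergeometric, ordinaryHypergeometricSeries_symm, ordinaryHypergeometric]

theorem ordinaryHypergeometric_zero_middle (a c z : ℂ) :
    ordinaryHypergeometric a 0 c z = 1 := by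
  rw [ordinaryHypergeometric_eq_tsum]
  dsimp only
  rw [tsum_eq_single 0]
  · simp
  · intro n hn
    simp [hn]

theorem ascPochhammer_eval_ne_zero {c : ℂ} (hc : ∀ k : ℕ, c + k ≠ 0) (n : ℕ) :
    (ascPochhammer ℂ n).eval c ≠ 0 := by
  rw [Ne, ascPochhammer_eval_eq_zero_iff]
  rintro ⟨k, -, hk⟩
  exact hc k (by rw [hk]; ring)

theorem ascPochhammer_succ_eval_sub_one (a : ℂ) (n : ℕ) :
    (ascPochhammer ℂ (n + 1)).eval (a - 1) = (a - 1) * (ascPochhammer ℂ n).eval a := by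
  rw [ascPochhammer_succ_left]
  simp [Polynomial.eval_comp]

theorem ascPochhammer_eval_sub_one_mul (c : ℂ) (n : ℕ) :
    (ascPochhammer ℂ n).eval (c - 1) * (c - 1 + n) = (c - 1) * (ascPochhammer ℂ n).eval c := by
  rw [← ascPochhammer_succ_eval_sub_one, ascPochhammer_succ_eval]

theorem ordinaryHypergeometricCoefficient_succ {a b c : ℂ} (n : ℕ) :
    ordinaryHypergeometricCoefficient a b c (n + 1) =
      ordinaryHypergeometricCoefficient a b c n * ((a + n) * (b + n) / ((c + n) * (n + 1))) := by
  simp only [ordinaryHypergeometricCoefficient, ascPochhammer_succ_eval, Nat.factorial_succ,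
    Nat.cast_mul, mul_inv, Nat.cast_add, Nat.cast_one, div_eq_mul_inv]
  ring

theorem ordinaryHypergeometricCoefficient_lower_sub_one {a b c : ℂ} (hc : ∀ k : ℕ, c + k ≠ 0)
    (hc1 : c - 1 ≠ 0) (n : ℕ) :
    (c - 1) * ordinaryHypergeometricCoefficient a b (c - 1) n =
      (c - 1 + n) * ordinaryHypergeometricCoefficient a b c n := by
  have h1 := ascPochhammer_eval_ne_zero hc n
  have h2 : (ascPochhammer ℂ n).eval (c - 1) ≠ 0 := by
    intro h
    have := ascPochhammer_eval_sub_one_mul c n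
    rw [h, zero_mul] at this
    exact mul_ne_zero hc1 h1 this.symm
  have h3 := ascPochhammer_eval_sub_one_mul c n
  have h4 : (n.factorial : ℂ) ≠ 0 := by exact_mod_cast n.factorial_ne_zero
  simp only [ordinaryHypergeometricCoefficient]
  field_simp
  linear_combination (-(ascPochhammer ℂ n).eval a * (ascPochhammer ℂ n).eval b) * h3

/-- From `(b-1)_{n+1} = (b-1) (b)_n`. The index shift avoids dividing by `b - 1`, which is zero in
the first Taylor term. -/
theorem ordinaryHypergeometricCoefficient_middle_sub_one {a b c : ℂ} (n : ℕ) :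
    ordinaryHypergeometricCoefficient a (b - 1) c (n + 1) =
      ordinaryHypergeometricCoefficient a b c n *
        ((a + n) * (b - 1) / ((c + n) * (n + 1))) := by
  simp only [ordinaryHypergeometricCoefficient, ascPochhammer_succ_eval_sub_one]
  simp only [ascPochhammer_succ_eval, Nat.factorial_succ,
    Nat.cast_mul, mul_inv, Nat.cast_add, Nat.cast_one, div_eq_mul_inv]
  ring

theorem ordinaryHypergeometricCoefficient_upper_sub_one {a b c : ℂ} (n : ℕ) :
    ordinaryHypergeometricCoefficient (a - 1) (b - 1) c (n + 1) =
      ordinaryHypergeometricCoefficient a b c n *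
        ((a - 1) * (b - 1) / ((c + n) * (n + 1))) := by
  simp only [ordinaryHypergeometricCoefficient, ascPochhammer_succ_eval_sub_one]
  simp only [ascPochhammer_succ_eval, Nat.factorial_succ,
    Nat.cast_mul, mul_inv, Nat.cast_add, Nat.cast_one, div_eq_mul_inv]
  ring

/-- Comparison of coefficients in a first-order relation
`R = γ F + z F' - z (β F + z F')` between power series. -/
theorem eq_of_hasSum_first_order {t w : ℕ → ℂ} {z F d R γ β : ℂ}
    (hF : HasSum (fun n => t n * z ^ n) F) (hd : HasSum (fun n : ℕ => n * t n * z ^ n) (z * d))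
    (hR : HasSum (fun n => w n * z ^ n) R) (h0 : w 0 = γ * t 0)
    (hs : ∀ n : ℕ, w (n + 1) = (γ + (n + 1)) * t (n + 1) - (β + n) * t n) :
    R = (γ - β * z) * F + z * (1 - z) * d := by
  have h1 : HasSum (fun n : ℕ => (γ + n) * t n * z ^ n) (γ * F + z * d) := by
    refine ((hF.mul_left γ).add hd).congr_fun ?_
    intro n; ring
  have h2 : HasSum (fun n : ℕ => (β + n) * t n * z ^ (n + 1)) (z * (β * F + z * d)) := by
    refine (((hF.mul_left β).add hd).mul_left z).congr_fun ?_
    intro n; ring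
  rw [← hasSum_nat_add_iff' 1] at h1 hR
  have h3 := h1.sub h2
  have h4 := hR.unique (h3.congr_fun fun n => ?_)
  · simp [h0] at h4
    linear_combination h4
  · simp only [hs]
    push_cast
    ring

/-! ### Contiguous relations involving the first derivative. -/

section Contiguous

variable {a b c z : ℂ}

/-- Lowering `c` multiplies the `n`-th coefficient by `(c-1+n)/(c-1)`, which is the action of `c - 1
+ z d/dz` up to the factor `c - 1`. -/
theorem ordinaryHypergeometric_contiguous_lower (hc : ∀ k : ℕ, c + k ≠ 0) (hc1 : c - 1 ≠ 0)
    (hz : ‖z‖ < 1) {d : ℂ} (hd : HasDerivAt (ordinaryHypergeometric a b c) d z) :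
    (c - 1) * ordinaryHypergeometric a b (c - 1) z =
      (c - 1) * ordinaryHypergeometric a b c z + z * d := by
  obtain ⟨d', hd', hs⟩ := ordinaryHypergeometric_exists_hasDerivAt a b c hz
  obtain rfl := hd.unique hd'
  refine ((ordinaryHypergeometric_hasSum a b (c - 1) hz).mul_left (c - 1)).unique ?_
  refine (((ordinaryHypergeometric_hasSum a b c hz).mul_left (c - 1)).add hs).congr_fun ?_
  intro n
  rw [← mul_assoc, ordinaryHypergeometricCoefficient_lower_sub_one hc hc1]
  ring

/-- With `θ = z d/dz`, the right side is `(c-1+θ)F - z(a+θ)F`; the coefficients agree because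
`(a+n)(b+n) - (a+n)(n+1) = (a+n)(b-1)`. -/
theorem ordinaryHypergeometric_contiguous_middle (hc : ∀ k : ℕ, c + k ≠ 0) (hc1 : c - 1 ≠ 0)
    (hz : ‖z‖ < 1) {d : ℂ} (hd : HasDerivAt (ordinaryHypergeometric a b c) d z) :
    (c - 1) * ordinaryHypergeometric a (b - 1) (c - 1) z =
      (c - 1 - a * z) * ordinaryHypergeometric a b c z + z * (1 - z) * d := by
  obtain ⟨d', hd', hs⟩ := ordinaryHypergeometric_exists_hasDerivAt a b c hz
  obtain rfl := hd.unique hd'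
  refine eq_of_hasSum_first_order (ordinaryHypergeometric_hasSum a b c hz) hs
    (w := fun n => (c - 1) * ordinaryHypergeometricCoefficient a (b - 1) (c - 1) n)
    (((ordinaryHypergeometric_hasSum a (b - 1) (c - 1) hz).mul_left (c - 1)).congr_fun
      fun n => by ring) (by simp [ordinaryHypergeometricCoefficient]) fun n => ?_
  have h1 := hc n
  have h2 : (n : ℂ) + 1 ≠ 0 := by exact_mod_cast n.succ_ne_zero
  rw [ordinaryHypergeometricCoefficient_lower_sub_one hc hc1,
    ordinaryHypergeometricCoefficient_middle_sub_one, ordinaryHypergeometricCoefficient_succ]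
  push_cast
  field_simp
  ring

/-- As before with `z(a+b-1+θ)F` subtracted; the coefficient identity is `(a+n)(b+n) -
(a+b-1+n)(n+1) = (a-1)(b-1)`. -/
theorem ordinaryHypergeometric_contiguous_upper (hc : ∀ k : ℕ, c + k ≠ 0) (hc1 : c - 1 ≠ 0)
    (hz : ‖z‖ < 1) {d : ℂ} (hd : HasDerivAt (ordinaryHypergeometric a b c) d z) :
    (c - 1) * ordinaryHypergeometric (a - 1) (b - 1) (c - 1) z =
      (c - 1 - (a + b - 1) * z) * ordinaryHypergeometric a b c z + z * (1 - z) * d := by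
  obtain ⟨d', hd', hs⟩ := ordinaryHypergeometric_exists_hasDerivAt a b c hz
  obtain rfl := hd.unique hd'
  refine eq_of_hasSum_first_order (ordinaryHypergeometric_hasSum a b c hz) hs
    (w := fun n => (c - 1) * ordinaryHypergeometricCoefficient (a - 1) (b - 1) (c - 1) n)
    (((ordinaryHypergeometric_hasSum (a - 1) (b - 1) (c - 1) hz).mul_left (c - 1)).congr_fun
      fun n => by ring) (by simp [ordinaryHypergeometricCoefficient]) fun n => ?_
  have h1 := hc n
  have h2 : (n : ℂ) + 1 ≠ 0 := by exact_mod_cast n.succ_ne_zero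
  rw [ordinaryHypergeometricCoefficient_lower_sub_one hc hc1,
    ordinaryHypergeometricCoefficient_upper_sub_one, ordinaryHypergeometricCoefficient_succ]
  push_cast
  field_simp
  ring

/-- The differential equation `(1 - z) F' = a F` of `F = ₂F₁(a, 1; 1; z) = (1 - z)^(-a)`,
multiplied by `z`. -/
theorem ordinaryHypergeometric_one_one_deriv
    (hz : ‖z‖ < 1) {d : ℂ} (hd : HasDerivAt (ordinaryHypergeometric a 1 1) d z) :
    z * (1 - z) * d = a * z * ordinaryHypergeometric a 1 1 z := by
  obtain ⟨d', hd', hs⟩ := ordinaryHypergeometric_exists_hasDerivAt a 1 1 hz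
  obtain rfl := hd.unique hd'
  -- For `b = c = 1` the coefficients satisfy `(n+1) t_{n+1} = (a+n) t_n`, so the comparison series
  -- is zero.
  have := eq_of_hasSum_first_order (ordinaryHypergeometric_hasSum a 1 1 hz) hs
    (w := fun n => 0) (R := 0) (γ := 0) (β := a)
    (by simp) (by simp) fun n => ?_
  · linear_combination -this
  have h2 : (n : ℂ) + 1 ≠ 0 := by exact_mod_cast n.succ_ne_zero
  have h3 : 1 + (n : ℂ) ≠ 0 := by rwa [add_comm]
  rw [ordinaryHypergeometricCoefficient_succ]
  field_simp
  ring

end Contiguous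

/-! ### Normalised kernels, their diagonal values and factorial forms. -/

/-- `besselKernelRight` divided by `Γ(2k)`; it vanishes for `k = 0`. -/
noncomputable def besselRiesz (ν : ℂ) (k : ℕ) (x y : ℝ) : ℂ :=
  1 / Complex.Gamma (2 * (k : ℂ)) * besselKernelRight ν k x y

/-- The coefficient of `B^(i-1) f (y)` in the Taylor formula with base point `y ≥ x`. -/
noncomputable def besselTaylorRight (ν : ℂ) (i : ℕ) (x y : ℝ) : ℂ :=
  1 / Complex.Gamma (2 * (i : ℂ) - 1) *
    (((y : ℂ) ^ 2 - (x : ℂ) ^ 2) / (2 * (y : ℂ))) ^ (2 * i - 2) *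
    ordinaryHypergeometric ((i : ℂ) + (ν - 1) / 2) ((i : ℂ) - 1) (2 * (i : ℂ) - 1)
      (1 - (x : ℂ) ^ 2 / (y : ℂ) ^ 2)

/-- The coefficient of `C_ν^(i-1) f (y)` in the Taylor formula with base point `y ≤ x`. -/
noncomputable def besselTaylorLeft (ν : ℂ) (i : ℕ) (x y : ℝ) : ℂ :=
  1 / Complex.Gamma (2 * (i : ℂ) - 1) *
    (((x : ℂ) ^ 2 - (y : ℂ) ^ 2) / (2 * (x : ℂ))) ^ (2 * i - 2) *
    ((y : ℂ) / (x : ℂ)) *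
    ordinaryHypergeometric ((i : ℂ) + (ν - 1) / 2) (i : ℂ) (2 * (i : ℂ) - 1)
      (1 - (y : ℂ) ^ 2 / (x : ℂ) ^ 2)

/-- Here `Γ(0) = 0` and `1 / 0 = 0` by convention, matching the zero of `1/Γ` at `0`. This makes the
lower end of the telescoping sums vanish. -/
theorem besselRiesz_zero (ν : ℂ) (x y : ℝ) : besselRiesz ν 0 x y = 0 := by
  simp [besselRiesz, Complex.Gamma_zero]

theorem besselRiesz_self (ν : ℂ) (k : ℕ) (x : ℝ) : besselRiesz ν k x x = 0 := by
  rcases k.eq_zero_or_pos with rfl | hk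
  · exact besselRiesz_zero ν x x
  · simp [besselRiesz, besselKernelRight, show 2 * k - 1 ≠ 0 by lia]

theorem besselTaylorRight_one (ν : ℂ) (x y : ℝ) : besselTaylorRight ν 1 x y = 1 := by
  norm_num [besselTaylorRight, ordinaryHypergeometric_zero_middle]

theorem besselTaylorRight_self (ν : ℂ) (j : ℕ) (x : ℝ) :
    besselTaylorRight ν (j + 2) x x = 0 := by
  simp [besselTaylorRight, show 2 * (j + 2) - 2 ≠ 0 by lia]

theorem besselTaylorLeft_one_self (ν : ℂ) {x : ℝ} (hx : 0 < x) :
    besselTaylorLeft ν 1 x x = 1 := by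
  have : (x : ℂ) ≠ 0 := by exact_mod_cast hx.ne'
  norm_num [besselTaylorLeft, this]

theorem besselTaylorLeft_self (ν : ℂ) (j : ℕ) (x : ℝ) :
    besselTaylorLeft ν (j + 2) x x = 0 := by
  simp [besselTaylorLeft, show 2 * (j + 2) - 2 ≠ 0 by lia]

theorem besselRiesz_succ (ν : ℂ) (j : ℕ) (x y : ℝ) :
    besselRiesz ν (j + 1) x y = 1 / ((2 * j + 1).factorial : ℂ) *
      (((y : ℂ) ^ 2 - (x : ℂ) ^ 2) / (2 * (y : ℂ))) ^ (2 * j + 1) *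
      ordinaryHypergeometric ((j : ℂ) + 1 + (ν - 1) / 2) ((j : ℂ) + 1) (2 * (j : ℂ) + 2)
        (1 - (x : ℂ) ^ 2 / (y : ℂ) ^ 2) := by
  have h : (2 : ℂ) * ((j + 1 : ℕ) : ℂ) = 2 * (j : ℂ) + 2 := by push_cast; ring
  have hG : Complex.Gamma (2 * (j : ℂ) + 2) = ((2 * j + 1).factorial : ℂ) := by
    rw [← Complex.Gamma_nat_eq_factorial]
    congr 1
    push_cast; ring
  rw [besselRiesz, besselKernelRight, h, hG, show 2 * (j + 1) - 1 = 2 * j + 1 by lia]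
  push_cast
  ring

theorem besselTaylorRight_succ (ν : ℂ) (j : ℕ) (x y : ℝ) :
    besselTaylorRight ν (j + 1) x y = 1 / ((2 * j).factorial : ℂ) *
      (((y : ℂ) ^ 2 - (x : ℂ) ^ 2) / (2 * (y : ℂ))) ^ (2 * j) *
      ordinaryHypergeometric ((j : ℂ) + 1 + (ν - 1) / 2) (j : ℂ) (2 * (j : ℂ) + 1)
        (1 - (x : ℂ) ^ 2 / (y : ℂ) ^ 2) := by
  have h : (2 : ℂ) * ((j + 1 : ℕ) : ℂ) - 1 = 2 * (j : ℂ) + 1 := by push_cast; ring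
  have h' : ((j + 1 : ℕ) : ℂ) - 1 = j := by push_cast; ring
  have hG : Complex.Gamma (2 * (j : ℂ) + 1) = ((2 * j).factorial : ℂ) := by
    rw [← Complex.Gamma_nat_eq_factorial]
    congr 1
    push_cast; ring
  rw [besselTaylorRight, h, h', hG, show 2 * (j + 1) - 2 = 2 * j by lia]
  push_cast
  ring

theorem besselTaylorLeft_succ (ν : ℂ) (j : ℕ) (x y : ℝ) :
    besselTaylorLeft ν (j + 1) x y = 1 / ((2 * j).factorial : ℂ) *
      (((x : ℂ) ^ 2 - (y : ℂ) ^ 2) / (2 * (x : ℂ))) ^ (2 * j) * ((y : ℂ) / (x : ℂ)) *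
      ordinaryHypergeometric ((j : ℂ) + 1 + (ν - 1) / 2) ((j : ℂ) + 1) (2 * (j : ℂ) + 1)
        (1 - (y : ℂ) ^ 2 / (x : ℂ) ^ 2) := by
  have h : (2 : ℂ) * ((j + 1 : ℕ) : ℂ) - 1 = 2 * (j : ℂ) + 1 := by push_cast; ring
  have hG : Complex.Gamma (2 * (j : ℂ) + 1) = ((2 * j).factorial : ℂ) := by
    rw [← Complex.Gamma_nat_eq_factorial]
    congr 1
    push_cast; ring
  rw [besselTaylorLeft, h, hG, show 2 * (j + 1) - 2 = 2 * j by lia]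
  push_cast
  ring

/-! ### The hypergeometric argument, and elementary derivatives. -/

/-- Every argument that occurs lies in `[0, 1)`, so power series suffice and no analytic
continuation is needed. -/
theorem norm_one_sub_sq_div_sq_lt_one {x y : ℝ} (hx : 0 < x) (hxy : x ≤ y) :
    ‖1 - (x : ℂ) ^ 2 / (y : ℂ) ^ 2‖ < 1 := by
  have hy : 0 < y := hx.trans_le hxy
  have h : 1 - (x : ℂ) ^ 2 / (y : ℂ) ^ 2 = ((1 - x ^ 2 / y ^ 2 : ℝ) : ℂ) := by push_cast; rfl
  have h1 : 0 < x ^ 2 / y ^ 2 := by positivity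
  have h2 : x ^ 2 / y ^ 2 ≤ 1 := by
    rw [div_le_one (by positivity)]
    gcongr
  rw [h, Complex.norm_real, Real.norm_eq_abs, abs_lt]
  constructor <;> linarith

theorem hasDerivAt_ofReal (y : ℝ) : HasDerivAt (fun y : ℝ => (y : ℂ)) 1 y :=
  (hasDerivAt_id (y : ℂ)).comp_ofReal

theorem hasDerivAt_one_sub_sq_div_sq_right (x : ℝ) {y : ℝ} (hy : 0 < y) :
    HasDerivAt (fun y : ℝ => 1 - (x : ℂ) ^ 2 / (y : ℂ) ^ 2)
      (2 * (x : ℂ) ^ 2 / (y : ℂ) ^ 3) y := by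
  have hy' : (y : ℂ) ≠ 0 := by exact_mod_cast hy.ne'
  refine ((((hasDerivAt_ofReal y).fun_pow 2).fun_inv (pow_ne_zero 2 hy')).const_mul
    ((x : ℂ) ^ 2) |>.const_sub 1).congr_deriv ?_
  field_simp
  ring

theorem hasDerivAt_one_sub_sq_div_sq_left (x y : ℝ) :
    HasDerivAt (fun y : ℝ => 1 - (y : ℂ) ^ 2 / (x : ℂ) ^ 2) (-(2 * (y : ℂ) / (x : ℂ) ^ 2)) y := by
  refine ((((hasDerivAt_ofReal y).fun_pow 2).div_const ((x : ℂ) ^ 2)).const_sub 1).congr_deriv ?_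
  simp

theorem hasDerivAt_sq_sub_sq_div_right (x : ℝ) {y : ℝ} (hy : 0 < y) :
    HasDerivAt (fun y : ℝ => ((y : ℂ) ^ 2 - (x : ℂ) ^ 2) / (2 * (y : ℂ)))
      (((y : ℂ) ^ 2 + (x : ℂ) ^ 2) / (2 * (y : ℂ) ^ 2)) y := by
  have hy' : (y : ℂ) ≠ 0 := by exact_mod_cast hy.ne'
  refine ((((hasDerivAt_ofReal y).fun_pow 2).sub_const ((x : ℂ) ^ 2)).fun_div
    ((hasDerivAt_ofReal y).const_mul 2) (mul_ne_zero two_ne_zero hy')).congr_deriv ?_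
  field_simp
  ring

theorem hasDerivAt_sq_sub_sq_div_left (x y : ℝ) :
    HasDerivAt (fun y : ℝ => ((x : ℂ) ^ 2 - (y : ℂ) ^ 2) / (2 * (x : ℂ))) (-((y : ℂ) / (x : ℂ))) y := by
  refine ((((hasDerivAt_ofReal y).fun_pow 2).const_sub ((x : ℂ) ^ 2)).div_const
    (2 * (x : ℂ))).congr_deriv ?_
  by_cases hx : (x : ℂ) = 0
  · simp [hx]
  field_simp
  norm_num

theorem two_mul_nat_add_succ_add_ne_zero (j m k : ℕ) : (2 * (j : ℂ) + (m + 1 : ℕ)) + k ≠ 0 := by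
  have : ((2 * j + (m + 1) + k : ℕ) : ℂ) ≠ 0 := by exact_mod_cast (by lia)
  push_cast at this ⊢
  exact this

theorem factorial_succ_cast (n : ℕ) :
    ((n + 1).factorial : ℂ) = ((n : ℂ) + 1) * (n.factorial : ℂ) := by
  rw [Nat.factorial_succ]; push_cast; ring

theorem two_mul_nat_add_one_ne_zero (j : ℕ) : 2 * (j : ℂ) + 1 ≠ 0 := by
  exact_mod_cast (2 * j).succ_ne_zero

theorem two_mul_nat_add_two_ne_zero (j : ℕ) : 2 * (j : ℂ) + 2 ≠ 0 := by
  exact_mod_cast (2 * j + 1).succ_ne_zero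

/-! ### Derivatives in `y` of the right kernel and coefficients. -/

section Right

variable (ν : ℂ) (j : ℕ) {x y : ℝ}

/-- Passing from `R_{j+1}` to `T_{j+1}` lowers the second and third parameters by one, as in
`ordinaryHypergeometric_contiguous_middle`. -/
theorem hasDerivAt_besselRiesz_right (hx : 0 < x) (hxy : x ≤ y) :
    HasDerivAt (fun y => besselRiesz ν (j + 1) x y)
      (besselTaylorRight ν (j + 1) x y + ν / y * besselRiesz ν (j + 1) x y) y := by
  have hy : 0 < y := hx.trans_le hxy
  have hy' : (y : ℂ) ≠ 0 := by exact_mod_cast hy.ne'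
  have hz := norm_one_sub_sq_div_sq_lt_one hx hxy
  obtain ⟨d, hd, -⟩ := ordinaryHypergeometric_exists_hasDerivAt
    ((j : ℂ) + 1 + (ν - 1) / 2) ((j : ℂ) + 1) (2 * (j : ℂ) + 2) hz
  have key := ordinaryHypergeometric_contiguous_middle
    (fun k => by simpa using two_mul_nat_add_succ_add_ne_zero j 1 k)
    (by convert two_mul_nat_add_one_ne_zero j using 1; ring) hz hd
  have hc := hd.comp y (hasDerivAt_one_sub_sq_div_sq_right x hy)
  have hs := (hasDerivAt_sq_sub_sq_div_right x hy).fun_pow (2 * j + 1)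
  have h := (hs.const_mul (1 / ((2 * j + 1).factorial : ℂ))).fun_mul hc
  simp only [besselRiesz_succ, besselTaylorRight_succ]
  refine h.congr_deriv ?_
  have e1 : 2 * (j : ℂ) + 2 - 1 = 2 * j + 1 := by ring
  have e2 : (j : ℂ) + 1 - 1 = j := by ring
  rw [e1, e2] at key
  have hf : ((2 * j).factorial : ℂ) ≠ 0 := by exact_mod_cast (2 * j).factorial_ne_zero
  have hj := two_mul_nat_add_one_ne_zero j
  rw [factorial_succ_cast]
  simp only [Nat.add_sub_cancel, Function.comp_def]
  push_cast
  rw [pow_succ _ (2 * j)]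
  generalize (((y : ℂ) ^ 2 - (x : ℂ) ^ 2) / (2 * (y : ℂ))) ^ (2 * j) = s
  -- Inserting the factor `c - 1 = 2j + 1` exposes the left side of the contiguous relation;
  -- afterwards only a rational identity in `F` and `d` remains.
  rw [show ∀ A B C : ℂ, 1 / A * s * B + C = 1 / (A * (2 * j + 1)) * s * ((2 * j + 1) * B) + C by
    intro A B C; field_simp, key]
  generalize ordinaryHypergeometric ((j : ℂ) + 1 + (ν - 1) / 2) ((j : ℂ) + 1) (2 * (j : ℂ) + 2)
    (1 - (x : ℂ) ^ 2 / (y : ℂ) ^ 2) = F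
  field_simp
  ring

theorem hasDerivAt_besselTaylorRight (hx : 0 < x) (hxy : x ≤ y) :
    HasDerivAt (fun y => besselTaylorRight ν (j + 1) x y) (besselRiesz ν j x y) y := by
  -- For `j = 0` the lower parameter is `c = 1`, where the contiguous relation degenerates; but `T_1
  -- = 1` and `R_0 = 0`.
  rcases j with _ | j
  · simp only [zero_add, besselTaylorRight_one, besselRiesz_zero]
    exact hasDerivAt_const _ _
  have hy : 0 < y := hx.trans_le hxy
  have hy' : (y : ℂ) ≠ 0 := by exact_mod_cast hy.ne'
  have hz := norm_one_sub_sq_div_sq_lt_one hx hxy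
  -- The upper parameters are exchanged, because here the one containing `ν` must be lowered.
  obtain ⟨d, hd, -⟩ := ordinaryHypergeometric_exists_hasDerivAt
    ((j : ℂ) + 1) ((j : ℂ) + 2 + (ν - 1) / 2) (2 * (j : ℂ) + 3) hz
  have key := ordinaryHypergeometric_contiguous_middle
    (fun k => by convert two_mul_nat_add_succ_add_ne_zero j 2 k using 1; norm_num)
    (by convert two_mul_nat_add_two_ne_zero j using 1; ring) hz hd
  have hc := hd.comp y (hasDerivAt_one_sub_sq_div_sq_right x hy)
  have hs := (hasDerivAt_sq_sub_sq_div_right x hy).fun_pow (2 * (j + 1))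
  have h := (hs.const_mul (1 / ((2 * (j + 1)).factorial : ℂ))).fun_mul hc
  have e3 : ((j + 1 : ℕ) : ℂ) + 1 = j + 2 := by push_cast; ring
  have e4 : 2 * ((j + 1 : ℕ) : ℂ) + 1 = 2 * j + 3 := by push_cast; ring
  simp only [besselRiesz_succ, besselTaylorRight_succ, e3, e4]
  simp only [Function.comp_def, ordinaryHypergeometric_comm ((j : ℂ) + 1) ((j : ℂ) + 2 + (ν - 1) / 2)] at h
  push_cast at h ⊢
  refine h.congr_deriv ?_
  have e1 : 2 * (j : ℂ) + 3 - 1 = 2 * j + 2 := by ring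
  have e2 : (j : ℂ) + 2 + (ν - 1) / 2 - 1 = j + 1 + (ν - 1) / 2 := by ring
  rw [e1, e2, ordinaryHypergeometric_comm, ordinaryHypergeometric_comm ((j : ℂ) + 1)] at key
  have hf : ((2 * j + 1).factorial : ℂ) ≠ 0 := by exact_mod_cast (2 * j + 1).factorial_ne_zero
  have hj := two_mul_nat_add_two_ne_zero j
  rw [show 2 * (j + 1) = 2 * j + 1 + 1 by ring, factorial_succ_cast]
  simp only [Nat.add_sub_cancel]
  push_cast
  rw [pow_succ _ (2 * j + 1)]
  generalize (((y : ℂ) ^ 2 - (x : ℂ) ^ 2) / (2 * (y : ℂ))) ^ (2 * j + 1) = s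
  rw [show ∀ A B : ℂ, 1 / A * s * B = 1 / (A * (2 * j + 2)) * s * ((2 * j + 2) * B) by
    intro A B; field_simp, key, show 2 * (j : ℂ) + 1 + 1 = 2 * j + 2 by ring]
  generalize ordinaryHypergeometric ((j : ℂ) + 2 + (ν - 1) / 2) ((j : ℂ) + 1) (2 * (j : ℂ) + 3)
    (1 - (x : ℂ) ^ 2 / (y : ℂ) ^ 2) = F
  field_simp
  ring

end Right

/-! ### Derivatives in `y` of the left kernel and coefficients. -/

section Left

variable (ν : ℂ) (j : ℕ) {x y : ℝ}

/-- The left kernel is the right one with its two points exchanged. Now `1 - y²/x²` is quadratic in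
`y`, and only the lower parameter drops. -/
theorem hasDerivAt_besselRiesz_left (hy : 0 < y) (hyx : y ≤ x) :
    HasDerivAt (fun y => besselRiesz ν (j + 1) y x) (-besselTaylorLeft ν (j + 1) x y) y := by
  have hx : 0 < x := hy.trans_le hyx
  have hx' : (x : ℂ) ≠ 0 := by exact_mod_cast hx.ne'
  have hz := norm_one_sub_sq_div_sq_lt_one hy hyx
  obtain ⟨d, hd, -⟩ := ordinaryHypergeometric_exists_hasDerivAt
    ((j : ℂ) + 1 + (ν - 1) / 2) ((j : ℂ) + 1) (2 * (j : ℂ) + 2) hz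
  have key := ordinaryHypergeometric_contiguous_lower
    (fun k => by simpa using two_mul_nat_add_succ_add_ne_zero j 1 k)
    (by convert two_mul_nat_add_one_ne_zero j using 1; ring) hz hd
  have hc := hd.comp y (hasDerivAt_one_sub_sq_div_sq_left x y)
  have hs := (hasDerivAt_sq_sub_sq_div_left x y).fun_pow (2 * j + 1)
  have h := (hs.const_mul (1 / ((2 * j + 1).factorial : ℂ))).fun_mul hc
  simp only [besselRiesz_succ, besselTaylorLeft_succ]
  refine h.congr_deriv ?_
  have e1 : 2 * (j : ℂ) + 2 - 1 = 2 * j + 1 := by ring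
  rw [e1] at key
  have hf : ((2 * j).factorial : ℂ) ≠ 0 := by exact_mod_cast (2 * j).factorial_ne_zero
  have hj := two_mul_nat_add_one_ne_zero j
  rw [factorial_succ_cast]
  simp only [Nat.add_sub_cancel, Function.comp_def]
  push_cast
  rw [pow_succ _ (2 * j)]
  generalize (((x : ℂ) ^ 2 - (y : ℂ) ^ 2) / (2 * (x : ℂ))) ^ (2 * j) = s
  rw [show ∀ A B C : ℂ, -(1 / A * s * C * B) =
      -(1 / (A * (2 * j + 1)) * s * C * ((2 * j + 1) * B)) by
    intro A B C; field_simp, key]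
  generalize ordinaryHypergeometric ((j : ℂ) + 1 + (ν - 1) / 2) ((j : ℂ) + 1) (2 * (j : ℂ) + 2)
    (1 - (y : ℂ) ^ 2 / (x : ℂ) ^ 2) = F
  field_simp
  ring

/-- Covers the endpoint `y = x`, excluded from `hasDerivAt_besselTaylorLeft`; the fundamental
theorem needs only continuity there. -/
theorem continuousAt_besselTaylorLeft (hy : 0 < y) (hyx : y ≤ x) :
    ContinuousAt (fun y => besselTaylorLeft ν (j + 1) x y) y := by
  have hz := norm_one_sub_sq_div_sq_lt_one hy hyx
  have hd := (ordinaryHypergeometric_differentiableAt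
    ((j : ℂ) + 1 + (ν - 1) / 2) ((j : ℂ) + 1) (2 * (j : ℂ) + 1) hz).continuousAt
  have hc := hd.comp (f := fun y : ℝ => 1 - (y : ℂ) ^ 2 / (x : ℂ) ^ 2)
    (hasDerivAt_one_sub_sq_div_sq_left x y).continuousAt
  simp only [besselTaylorLeft_succ]
  refine ContinuousAt.mul (by fun_prop) hc

/-- For `j ≥ 1` all three parameters drop by one. For `j = 0` the lower parameter is `1`, and the
equation for `₂F₁(a, 1; 1; z)` takes over. -/
theorem hasDerivAt_besselTaylorLeft (hy : 0 < y) (hyx : y < x) :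
    HasDerivAt (fun y => besselTaylorLeft ν (j + 1) x y)
      (-besselRiesz ν j y x - ν / y * besselTaylorLeft ν (j + 1) x y) y := by
  have hx : 0 < x := hy.trans hyx
  have hx' : (x : ℂ) ≠ 0 := by exact_mod_cast hx.ne'
  have hy' : (y : ℂ) ≠ 0 := by exact_mod_cast hy.ne'
  have hz := norm_one_sub_sq_div_sq_lt_one hy hyx.le
  have hcs := hasDerivAt_one_sub_sq_div_sq_left x y
  have hq : HasDerivAt (fun y : ℝ => (y : ℂ) / (x : ℂ)) (1 / x) y :=
    (hasDerivAt_ofReal y).div_const _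
  rcases j with _ | j
  · obtain ⟨d, hd, -⟩ := ordinaryHypergeometric_exists_hasDerivAt
      (1 + (ν - 1) / 2) 1 1 hz
    have key := ordinaryHypergeometric_one_one_deriv hz hd
    have h := hq.fun_mul (hd.comp y hcs)
    simp only [besselRiesz_zero, besselTaylorLeft_succ]
    simp only [Nat.cast_zero, mul_zero, Nat.factorial_zero, pow_zero, Nat.cast_one, zero_add,
      mul_one, div_one, one_mul, neg_zero, zero_sub]
    refine h.congr_deriv ?_
    -- The equation in `key` carries a factor `z = 1 - y²/x²`, which can be cancelled only for `y <
    -- x`.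
    have hxy : (x : ℂ) ^ 2 - (y : ℂ) ^ 2 ≠ 0 := by
      have : x ^ 2 - y ^ 2 ≠ 0 := by nlinarith
      exact_mod_cast this
    simp only [Function.comp_def]
    generalize ordinaryHypergeometric (1 + (ν - 1) / 2) 1 1
      (1 - (y : ℂ) ^ 2 / (x : ℂ) ^ 2) = F at key ⊢
    field_simp at key ⊢
    linear_combination -key
  obtain ⟨d, hd, -⟩ := ordinaryHypergeometric_exists_hasDerivAt
    ((j : ℂ) + 2 + (ν - 1) / 2) ((j : ℂ) + 2) (2 * (j : ℂ) + 3) hz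
  have key := ordinaryHypergeometric_contiguous_upper
    (fun k => by convert two_mul_nat_add_succ_add_ne_zero j 2 k using 1; norm_num)
    (by convert two_mul_nat_add_two_ne_zero j using 1; ring) hz hd
  have hc := hd.comp y hcs
  have hs := (hasDerivAt_sq_sub_sq_div_left x y).fun_pow (2 * (j + 1))
  have h := ((hs.const_mul (1 / ((2 * (j + 1)).factorial : ℂ))).fun_mul hq).fun_mul hc
  have e3 : ((j + 1 : ℕ) : ℂ) + 1 = j + 2 := by push_cast; ring
  have e4 : 2 * ((j + 1 : ℕ) : ℂ) + 1 = 2 * j + 3 := by push_cast; ring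
  simp only [besselRiesz_succ, besselTaylorLeft_succ, e3, e4]
  simp only [Function.comp_def] at h
  refine h.congr_deriv ?_
  have e1 : 2 * (j : ℂ) + 3 - 1 = 2 * j + 2 := by ring
  have e2 : (j : ℂ) + 2 + (ν - 1) / 2 - 1 = j + 1 + (ν - 1) / 2 := by ring
  have e5 : (j : ℂ) + 2 - 1 = j + 1 := by ring
  rw [e1, e2, e5] at key
  have hf : ((2 * j + 1).factorial : ℂ) ≠ 0 := by exact_mod_cast (2 * j + 1).factorial_ne_zero
  have hj := two_mul_nat_add_two_ne_zero j
  rw [show 2 * (j + 1) = 2 * j + 1 + 1 by ring, factorial_succ_cast]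
  simp only [Nat.add_sub_cancel]
  push_cast
  rw [pow_succ _ (2 * j + 1)]
  generalize (((x : ℂ) ^ 2 - (y : ℂ) ^ 2) / (2 * (x : ℂ))) ^ (2 * j + 1) = s
  rw [show ∀ A B C : ℂ, -(1 / A * s * B) - C = -(1 / (A * (2 * j + 2)) * s * ((2 * j + 2) * B)) - C by
    intro A B C; field_simp, key, show 2 * (j : ℂ) + 1 + 1 = 2 * j + 2 by ring]
  generalize ordinaryHypergeometric ((j : ℂ) + 2 + (ν - 1) / 2) ((j : ℂ) + 2) (2 * (j : ℂ) + 3)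
    (1 - (y : ℂ) ^ 2 / (x : ℂ) ^ 2) = F
  field_simp
  ring

end Left

/-! ### Regularity of the iterated operators on `I`. -/

section Operators

variable {I : Set ℝ} {ν : ℂ} {g : ℝ → ℂ}

theorem uniqueDiffOn_of_ordConnected_nontrivial (hI : I.OrdConnected) (hInt : I.Nontrivial) :
    UniqueDiffOn ℝ I := by
  refine uniqueDiffOn_convex hI.convex ?_
  obtain ⟨a, ha, b, hb, hab⟩ := hInt.exists_lt
  exact ⟨(a + b) / 2, interior_mono ((Ioo_subset_Icc_self).trans (hI.out ha hb))
    (by rw [interior_Ioo]; constructor <;> linarith)⟩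

theorem contDiffOn_const_div_ofReal (hIpos : I ⊆ Ioi 0) {n : WithTop ℕ∞} :
    ContDiffOn ℝ n (fun y : ℝ => ν / (y : ℂ)) I :=
  contDiffOn_const.mul (ContDiffOn.inv (f := fun y : ℝ => (y : ℂ))
    Complex.ofRealCLM.contDiff.contDiffOn fun y hy => by
      have : (0 : ℝ) < y := hIpos hy
      exact_mod_cast this.ne')

theorem contDiffOn_besselOp (hI : UniqueDiffOn ℝ I) (hIpos : I ⊆ Ioi 0) {n : ℕ}
    (hg : ContDiffOn ℝ ((n + 2 : ℕ) : WithTop ℕ∞) g I) :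
    ContDiffOn ℝ (n : WithTop ℕ∞) (besselOp ν I g) I := by
  have h1 : ContDiffOn ℝ ((n + 1 : ℕ) : WithTop ℕ∞) (derivWithin g I) I :=
    hg.derivWithin hI (by norm_cast)
  have h2 : ContDiffOn ℝ (n : WithTop ℕ∞) (derivWithin (derivWithin g I) I) I :=
    h1.derivWithin hI (by norm_cast)
  exact h2.add ((contDiffOn_const_div_ofReal hIpos).mul (h1.of_le (by norm_cast; lia)))

theorem contDiffOn_besselAdjointOp (hI : UniqueDiffOn ℝ I) (hIpos : I ⊆ Ioi 0) {n : ℕ}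
    (hg : ContDiffOn ℝ ((n + 2 : ℕ) : WithTop ℕ∞) g I) :
    ContDiffOn ℝ (n : WithTop ℕ∞) (besselAdjointOp ν I g) I := by
  have h1 : ContDiffOn ℝ ((n + 1 : ℕ) : WithTop ℕ∞) (derivWithin g I) I :=
    hg.derivWithin hI (by norm_cast)
  have h2 : ContDiffOn ℝ (n : WithTop ℕ∞) (derivWithin (derivWithin g I) I) I :=
    h1.derivWithin hI (by norm_cast)
  have h3 : ContDiffOn ℝ ((n + 2 : ℕ) : WithTop ℕ∞) (fun y : ℝ => ν / (y : ℂ) * g y) I :=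
    (contDiffOn_const_div_ofReal hIpos).mul hg
  exact h2.sub (h3.derivWithin hI (by norm_cast; lia))

theorem contDiffOn_iterate_of_order_two {T : (ℝ → ℂ) → ℝ → ℂ}
    (hT : ∀ (n : ℕ) (g : ℝ → ℂ), ContDiffOn ℝ ((n + 2 : ℕ) : WithTop ℕ∞) g I →
      ContDiffOn ℝ (n : WithTop ℕ∞) (T g) I) (j n : ℕ)
    (hg : ContDiffOn ℝ ((n + 2 * j : ℕ) : WithTop ℕ∞) g I) :
    ContDiffOn ℝ (n : WithTop ℕ∞) (T^[j] g) I := by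
  induction j generalizing n with
  | zero => simpa using hg
  | succ j ih =>
    rw [Function.iterate_succ_apply']
    exact hT n _ (ih (n + 2) (by convert hg using 2; ring))

theorem hasDerivAt_derivWithin_of_mem_interior (hg : DifferentiableOn ℝ g I) {y : ℝ}
    (hy : I ∈ nhds y) : HasDerivAt g (derivWithin g I y) y :=
  ((hg y (mem_of_mem_nhds hy)).hasDerivWithinAt).hasDerivAt hy

/-- Converts the weighted boundary term into `Dg - (ν/x)g`, the form used in the telescoping
argument because its derivative is `C_ν g`. -/
theorem cpow_mul_derivWithin_cpow_neg_mul (hI : UniqueDiffOn ℝ I) (hIpos : I ⊆ Ioi 0)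
    (hg : DifferentiableOn ℝ g I) {a : ℝ} (ha : a ∈ I) :
    (a : ℂ) ^ ν * derivWithin (fun y : ℝ => (y : ℂ) ^ (-ν) * g y) I a =
      derivWithin g I a - ν / (a : ℂ) * g a := by
  have ha0 : (0 : ℝ) < a := hIpos ha
  have ha' : (a : ℂ) ≠ 0 := by exact_mod_cast ha0.ne'
  have h1 : HasDerivAt (fun y : ℝ => (y : ℂ) ^ (-ν)) (-ν * (a : ℂ) ^ (-ν - 1) * 1) a :=
    ((hasDerivAt_id (a : ℂ)).cpow_const (Or.inl (by simpa using ha0))).comp_ofReal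
  have h2 := (h1.hasDerivWithinAt (s := I)).fun_mul (hg a ha).hasDerivWithinAt
  rw [h2.derivWithin (hI a ha), Complex.cpow_sub _ _ ha', Complex.cpow_one, Complex.cpow_neg]
  have h3 : (a : ℂ) ^ ν ≠ 0 := by simp [Complex.cpow_eq_zero_iff, ha']
  field_simp
  ring

end Operators

theorem sum_Icc_one_eq_sum_range {M : Type*} [AddCommMonoid M] (F : ℕ → M) (k : ℕ) :
    ∑ i ∈ Finset.Icc 1 k, F i = ∑ j ∈ Finset.range k, F (j + 1) := by
  rw [Finset.range_eq_Ico, Finset.sum_Ico_add' F 0 k 1]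
  rfl

/-! ### The Taylor formulas by telescoping. -/

section Taylor

variable {ν : ℂ} {k : ℕ} {I : Set ℝ} {f : ℝ → ℂ}

theorem bessel_taylor_right (hI : I.OrdConnected) (hIpos : I ⊆ Ioi 0) (hInt : I.Nontrivial)
    (hk : 1 ≤ k) (hf : ContDiffOn ℝ ((2 * k : ℕ) : WithTop ℕ∞) f I) {b x : ℝ} (hb : b ∈ I)
    (hx : x ∈ I) (hxb : x ≤ b) :
    IntervalIntegrable (fun y => besselRiesz ν k x y * (besselOp ν I)^[k] f y) volume x b ∧
    f x = ∑ j ∈ Finset.range k,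
        (besselTaylorRight ν (j + 1) x b * (besselOp ν I)^[j] f b -
          besselRiesz ν (j + 1) x b * derivWithin ((besselOp ν I)^[j] f) I b) +
      ∫ y in x..b, besselRiesz ν k x y * (besselOp ν I)^[k] f y := by
  have hU := uniqueDiffOn_of_ordConnected_nontrivial hI hInt
  have hx0 : (0 : ℝ) < x := hIpos hx
  have hsub : Icc x b ⊆ I := hI.out hx hb
  have hreg (j n : ℕ) (hjn : n + 2 * j ≤ 2 * k) :
      ContDiffOn ℝ (n : WithTop ℕ∞) ((besselOp ν I)^[j] f) I :=
    contDiffOn_iterate_of_order_two (fun n g hg => contDiffOn_besselOp hU hIpos hg) j n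
      (hf.of_le (by exact_mod_cast hjn))
  have hreg' (j : ℕ) (hj : j < k) :
      ContDiffOn ℝ (1 : ℕ) (derivWithin ((besselOp ν I)^[j] f) I) I :=
    (hreg j 2 (by lia)).derivWithin hU (by norm_cast)
  have hKc (j : ℕ) : ContinuousOn (fun y => besselRiesz ν (j + 1) x y) (Icc x b) :=
    fun y hy => (hasDerivAt_besselRiesz_right ν j hx0 hy.1).continuousAt.continuousWithinAt
  have hLc (j : ℕ) : ContinuousOn (fun y => besselTaylorRight ν (j + 1) x y) (Icc x b) :=
    fun y hy => (hasDerivAt_besselTaylorRight ν j hx0 hy.1).continuousAt.continuousWithinAt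
  obtain ⟨m, rfl⟩ : ∃ m, k = m + 1 := ⟨k - 1, by lia⟩
  have hint : IntervalIntegrable
      (fun y => besselRiesz ν (m + 1) x y * (besselOp ν I)^[m + 1] f y) volume x b := by
    apply ContinuousOn.intervalIntegrable
    rw [uIcc_of_le hxb]
    exact (hKc m).mul ((hreg (m + 1) 0 (by lia)).continuousOn.mono hsub)
  refine ⟨hint, ?_⟩
  have hFTC := intervalIntegral.integral_eq_sub_of_hasDerivAt_of_le hxb
    (f := fun y => ∑ j ∈ Finset.range (m + 1),
        (besselRiesz ν (j + 1) x y * derivWithin ((besselOp ν I)^[j] f) I y -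
          besselTaylorRight ν (j + 1) x y * (besselOp ν I)^[j] f y))
    (continuousOn_finsetSum _ fun j hj => by
      have hj' : j < m + 1 := Finset.mem_range.1 hj
      exact ((hKc j).mul ((hreg' j hj').continuousOn.mono hsub)).sub
        ((hLc j).mul ((hreg j 2 (by lia)).continuousOn.mono hsub)))
    (fun y hy => ?_) hint
  · rw [hFTC]
    -- At `y = x` only the `j = 0` term survives, through `T_1 = 1`.
    have hxx : ∑ j ∈ Finset.range (m + 1),
        (besselRiesz ν (j + 1) x x * derivWithin ((besselOp ν I)^[j] f) I x -
          besselTaylorRight ν (j + 1) x x * (besselOp ν I)^[j] f x) = -f x := by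
      rw [Finset.sum_range_succ']
      simp [besselRiesz_self, besselTaylorRight_self, besselTaylorRight_one]
    simp only [hxx, ← Finset.sum_add_distrib, sub_neg_eq_add, ← add_assoc]
    simp
  · have hyI : I ∈ nhds y := Filter.mem_of_superset (Icc_mem_nhds hy.1 hy.2) hsub
    -- The terms `T_{j+1} D B^j f` cancel, and `D²` combines with `(ν/y) D` into one more
    -- application of `B`.
    have hterm (j : ℕ) (hj : j ∈ Finset.range (m + 1)) : HasDerivAt
        (fun y => besselRiesz ν (j + 1) x y * derivWithin ((besselOp ν I)^[j] f) I y -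
          besselTaylorRight ν (j + 1) x y * (besselOp ν I)^[j] f y)
        (besselRiesz ν (j + 1) x y * (besselOp ν I)^[j + 1] f y -
          besselRiesz ν j x y * (besselOp ν I)^[j] f y) y := by
      have hj' : j < m + 1 := Finset.mem_range.1 hj
      have d1 := hasDerivAt_derivWithin_of_mem_interior
        ((hreg' j hj').differentiableOn (by simp)) hyI
      have d0 := hasDerivAt_derivWithin_of_mem_interior
        ((hreg j 2 (by lia)).differentiableOn (by simp)) hyI
      refine (((hasDerivAt_besselRiesz_right ν j hx0 hy.1.le).fun_mul d1).fun_sub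
        ((hasDerivAt_besselTaylorRight ν j hx0 hy.1.le).fun_mul d0)).congr_deriv ?_
      rw [Function.iterate_succ_apply', besselOp]
      ring
    refine (HasDerivAt.fun_sum hterm).congr_deriv ?_
    rw [Finset.sum_range_sub (fun j => besselRiesz ν j x y * (besselOp ν I)^[j] f y)]
    simp [besselRiesz_zero]

theorem bessel_taylor_left (hI : I.OrdConnected) (hIpos : I ⊆ Ioi 0) (hInt : I.Nontrivial)
    (hk : 1 ≤ k) (hf : ContDiffOn ℝ ((2 * k : ℕ) : WithTop ℕ∞) f I) {a x : ℝ} (ha : a ∈ I)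
    (hx : x ∈ I) (hax : a ≤ x) :
    IntervalIntegrable (fun y => besselRiesz ν k y x * (besselAdjointOp ν I)^[k] f y)
      volume a x ∧
    f x = ∑ j ∈ Finset.range k,
        (besselTaylorLeft ν (j + 1) x a * (besselAdjointOp ν I)^[j] f a +
          besselRiesz ν (j + 1) a x * (derivWithin ((besselAdjointOp ν I)^[j] f) I a -
            ν / (a : ℂ) * (besselAdjointOp ν I)^[j] f a)) +
      ∫ y in a..x, besselRiesz ν k y x * (besselAdjointOp ν I)^[k] f y := by
  have hU := uniqueDiffOn_of_ordConnected_nontrivial hI hInt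
  have hx0 : (0 : ℝ) < x := hIpos hx
  have ha0 : (0 : ℝ) < a := hIpos ha
  have hsub : Icc a x ⊆ I := hI.out ha hx
  have hreg (j n : ℕ) (hjn : n + 2 * j ≤ 2 * k) :
      ContDiffOn ℝ (n : WithTop ℕ∞) ((besselAdjointOp ν I)^[j] f) I :=
    contDiffOn_iterate_of_order_two (fun n g hg => contDiffOn_besselAdjointOp hU hIpos hg) j n
      (hf.of_le (by exact_mod_cast hjn))
  have hreg' (j : ℕ) (hj : j < k) :
      ContDiffOn ℝ (1 : ℕ) (derivWithin ((besselAdjointOp ν I)^[j] f) I) I :=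
    (hreg j 2 (by lia)).derivWithin hU (by norm_cast)
  have hKc (j : ℕ) : ContinuousOn (fun y => besselRiesz ν (j + 1) y x) (Icc a x) :=
    fun y hy => (hasDerivAt_besselRiesz_left ν j (ha0.trans_le hy.1)
      hy.2).continuousAt.continuousWithinAt
  have hMc (j : ℕ) : ContinuousOn (fun y => besselTaylorLeft ν (j + 1) x y) (Icc a x) :=
    fun y hy => (continuousAt_besselTaylorLeft ν j (ha0.trans_le hy.1) hy.2).continuousWithinAt
  have hqc : ContinuousOn (fun y : ℝ => ν / (y : ℂ)) I :=
    (contDiffOn_const_div_ofReal hIpos (n := 0)).continuousOn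
  obtain ⟨m, rfl⟩ : ∃ m, k = m + 1 := ⟨k - 1, by lia⟩
  have hint : IntervalIntegrable
      (fun y => besselRiesz ν (m + 1) y x * (besselAdjointOp ν I)^[m + 1] f y) volume a x := by
    apply ContinuousOn.intervalIntegrable
    rw [uIcc_of_le hax]
    exact (hKc m).mul ((hreg (m + 1) 0 (by lia)).continuousOn.mono hsub)
  refine ⟨hint, ?_⟩
  have hFTC := intervalIntegral.integral_eq_sub_of_hasDerivAt_of_le hax
    (f := fun y => ∑ j ∈ Finset.range (m + 1),
        (besselTaylorLeft ν (j + 1) x y * (besselAdjointOp ν I)^[j] f y +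
          besselRiesz ν (j + 1) y x * (derivWithin ((besselAdjointOp ν I)^[j] f) I y -
            ν / (y : ℂ) * (besselAdjointOp ν I)^[j] f y)))
    (continuousOn_finsetSum _ fun j hj => by
      have hj' : j < m + 1 := Finset.mem_range.1 hj
      have hc := (hreg j 2 (by lia)).continuousOn
      exact ((hMc j).mul (hc.mono hsub)).add ((hKc j).mul
        (((hreg' j hj').continuousOn.sub (hqc.mul hc)).mono hsub)))
    (fun y hy => ?_) hint
  · rw [hFTC]
    have hxx : ∑ j ∈ Finset.range (m + 1),
        (besselTaylorLeft ν (j + 1) x x * (besselAdjointOp ν I)^[j] f x +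
          besselRiesz ν (j + 1) x x * (derivWithin ((besselAdjointOp ν I)^[j] f) I x -
            ν / (x : ℂ) * (besselAdjointOp ν I)^[j] f x)) = f x := by
      rw [Finset.sum_range_succ']
      simp [besselRiesz_self, besselTaylorLeft_self, besselTaylorLeft_one_self ν hx0]
    rw [hxx]
    ring
  · have hyI : I ∈ nhds y := Filter.mem_of_superset (Icc_mem_nhds hy.1 hy.2) hsub
    have hy0 : 0 < y := ha0.trans hy.1
    have hy' : (y : ℂ) ≠ 0 := by exact_mod_cast hy0.ne'
    have hterm (j : ℕ) (hj : j ∈ Finset.range (m + 1)) : HasDerivAt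
        (fun y => besselTaylorLeft ν (j + 1) x y * (besselAdjointOp ν I)^[j] f y +
          besselRiesz ν (j + 1) y x * (derivWithin ((besselAdjointOp ν I)^[j] f) I y -
            ν / (y : ℂ) * (besselAdjointOp ν I)^[j] f y))
        (besselRiesz ν (j + 1) y x * (besselAdjointOp ν I)^[j + 1] f y -
          besselRiesz ν j y x * (besselAdjointOp ν I)^[j] f y) y := by
      have hj' : j < m + 1 := Finset.mem_range.1 hj
      have hd0 := (hreg j 2 (by lia)).differentiableOn (by simp)
      have d1 := hasDerivAt_derivWithin_of_mem_interior
        ((hreg' j hj').differentiableOn (by simp)) hyI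
      have d0 := hasDerivAt_derivWithin_of_mem_interior hd0 hyI
      -- The derivative of `(ν/y) g` stays unexpanded, exactly as it appears in `besselAdjointOp`.
      have dq := hasDerivAt_derivWithin_of_mem_interior
        (((contDiffOn_const_div_ofReal (ν := ν) hIpos (n := 1)).differentiableOn
          (by simp)).fun_mul hd0) hyI
      refine (((hasDerivAt_besselTaylorLeft ν j hy0 hy.2).fun_mul d0).fun_add
        ((hasDerivAt_besselRiesz_left ν j hy0 hy.2.le).fun_mul (d1.fun_sub dq))).congr_deriv ?_
      rw [Function.iterate_succ_apply', besselAdjointOp]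
      ring
    refine (HasDerivAt.fun_sum hterm).congr_deriv ?_
    rw [Finset.sum_range_sub (fun j => besselRiesz ν j y x * (besselAdjointOp ν I)^[j] f y)]
    simp [besselRiesz_zero]

end Taylor

/-! ### Translation back to the unnormalised kernels. -/

theorem theorem7 (ν : ℂ) (hν : 0 ≤ ν.re) (k : ℕ) (hk : 1 ≤ k)
    (I : Set ℝ) (hI : I.OrdConnected) (hIpos : I ⊆ Set.Ioi 0) (hInt : I.Nontrivial)
    (f : ℝ → ℂ) (hf : ContDiffOn ℝ ((2 * k : ℕ) : WithTop ℕ∞) f I) :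
    (∀ b ∈ I, ∀ x ∈ I, x ≤ b →
      IntervalIntegrable (fun y => besselKernelRight ν k x y * (besselOp ν I)^[k] f y)
        volume x b ∧
      f x = ∑ i ∈ Finset.Icc 1 k,
          (1 / Complex.Gamma (2 * (i : ℂ) - 1) *
              (((b : ℂ) ^ 2 - (x : ℂ) ^ 2) / (2 * (b : ℂ))) ^ (2 * i - 2) *
              ordinaryHypergeometric ((i : ℂ) + (ν - 1) / 2) ((i : ℂ) - 1) (2 * (i : ℂ) - 1)
                (1 - (x : ℂ) ^ 2 / (b : ℂ) ^ 2) *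
              (besselOp ν I)^[i - 1] f b
            - 1 / Complex.Gamma (2 * (i : ℂ)) *
              (((b : ℂ) ^ 2 - (x : ℂ) ^ 2) / (2 * (b : ℂ))) ^ (2 * i - 1) *
              ordinaryHypergeometric ((i : ℂ) + (ν - 1) / 2) (i : ℂ) (2 * (i : ℂ))
                (1 - (x : ℂ) ^ 2 / (b : ℂ) ^ 2) *
              derivWithin ((besselOp ν I)^[i - 1] f) I b)
        + besselIntegralRight ν k b ((besselOp ν I)^[k] f) x) ∧
    (∀ a ∈ I, ∀ x ∈ I, a ≤ x →
      IntervalIntegrable (fun y => besselKernelLeft ν k x y * (besselAdjointOp ν I)^[k] f y)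
        volume a x ∧
      f x = ∑ i ∈ Finset.Icc 1 k,
          (1 / Complex.Gamma (2 * (i : ℂ) - 1) *
              (((x : ℂ) ^ 2 - (a : ℂ) ^ 2) / (2 * (x : ℂ))) ^ (2 * i - 2) *
              ((a : ℂ) / (x : ℂ)) *
              ordinaryHypergeometric ((i : ℂ) + (ν - 1) / 2) (i : ℂ) (2 * (i : ℂ) - 1)
                (1 - (a : ℂ) ^ 2 / (x : ℂ) ^ 2) *
              (besselAdjointOp ν I)^[i - 1] f a
            + 1 / Complex.Gamma (2 * (i : ℂ)) *
              (((x : ℂ) ^ 2 - (a : ℂ) ^ 2) / (2 * (x : ℂ))) ^ (2 * i - 1) *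
              ordinaryHypergeometric ((i : ℂ) + (ν - 1) / 2) (i : ℂ) (2 * (i : ℂ))
                (1 - (a : ℂ) ^ 2 / (x : ℂ) ^ 2) *
              (a : ℂ) ^ ν *
              derivWithin (fun y : ℝ => (y : ℂ) ^ (-ν) * (besselAdjointOp ν I)^[i - 1] f y) I a)
        + besselIntegralLeft ν k a ((besselAdjointOp ν I)^[k] f) x) := by
  have hU := uniqueDiffOn_of_ordConnected_nontrivial hI hInt
  have hG : Complex.Gamma (2 * (k : ℂ)) ≠ 0 := by
    apply Complex.Gamma_ne_zero_of_re_pos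
    simpa using by lia
  refine ⟨fun b hb x hx hxb => ?_, fun a ha x hx hax => ?_⟩
  · obtain ⟨h1, h2⟩ := bessel_taylor_right (ν := ν) hI hIpos hInt hk hf hb hx hxb
    refine ⟨?_, ?_⟩
    -- Multiplying by `Γ(2k) ≠ 0` removes the normalisation of the kernel.
    · refine (h1.const_mul (Complex.Gamma (2 * (k : ℂ)))).congr fun y _ => ?_
      simp only [besselRiesz]
      field_simp
    · rw [h2, sum_Icc_one_eq_sum_range, besselIntegralRight,
        ← intervalIntegral.integral_const_mul]
      simp only [besselRiesz, besselTaylorRight, besselKernelRight, Nat.add_sub_cancel, mul_assoc]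
  · obtain ⟨h1, h2⟩ := bessel_taylor_left (ν := ν) hI hIpos hInt hk hf ha hx hax
    refine ⟨?_, ?_⟩
    · refine (h1.const_mul (Complex.Gamma (2 * (k : ℂ)))).congr fun y _ => ?_
      simp only [besselRiesz, besselKernelLeft, besselKernelRight]
      field_simp
    · rw [h2, sum_Icc_one_eq_sum_range, besselIntegralLeft,
        ← intervalIntegral.integral_const_mul]
      congr 1
      · refine Finset.sum_congr rfl fun j hj => ?_
        have hj' : j < k := Finset.mem_range.1 hj
        have hd : DifferentiableOn ℝ ((besselAdjointOp ν I)^[j] f) I :=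
          (contDiffOn_iterate_of_order_two
            (fun n g hg => contDiffOn_besselAdjointOp (ν := ν) hU hIpos hg) j 1
            (hf.of_le (by norm_cast; lia))).differentiableOn (by simp)
        rw [← cpow_mul_derivWithin_cpow_neg_mul hU hIpos hd ha]
        simp only [besselRiesz, besselTaylorLeft, besselKernelRight, Nat.add_sub_cancel, mul_assoc]
      · simp only [besselRiesz, besselKernelLeft, besselKernelRight, mul_assoc]
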